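/- Let $W:[0,1]^2\to[0,1]$ be a graphon (symmetric and Borel measurable) that is continuous at almost every point of $[0,1]^2$, let $g\in L_\infty([0,1])$, and let $u\in C^1([0,\infty),L_\infty([0,1]))$ be the solution of the continuum voting model $$\frac{\partial u(x,t)}{\partial t}=\int_0^1 W(x,y)\big(u(y,t)-u(x,t)\big)\,dy\quad(t>0),\qquad u(\cdot,0)=g .$$ Assume the positivity condition: for some $T_0>0$, $$\min_{t\in[0,T_0]}\int_{[0,1]^2}\big(u(y,t)-u(x,t)\big)^2\,W(x,y)\,\big(1-W(x,y)\big)\,dx\,dy>0 .$$ For each $n\ge 1$ let $\mathbb{G}_n(W)$ be the $W$-random graph: the random simple graph on $\{1,\dots,n\}$ in which the pairs $\{i,j\}$, $i\ne j$, are edges independently with probability $W(i/n,j/n)$. Let $\beta^{(n)}_{ij}=1$ if $\{i,j\}$ is an edge of $\mathbb{G}_n(W)$ and $\beta^{(n)}_{ij}=0$ otherwise, and let $(u^{(n)}_i)_{i\le n}$ be the solution of the finite voting model $$\frac{du^{(n)}_i(t)}{dt}=\frac1n\sum_{j=1}^n\beta^{(n)}_{ij}\big(u^{(n)}_j(t)-u^{(n)}_i(t)\big)\quad(t>0),\qquad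 u^{(n)}_i(0)=n\int_{(i-1)/n}^{i/n}g(y)\,dy .$$ Put $u_n(x,t)=u^{(n)}_i(t)$ for $x\in I^n_i$, where $I^n_1=[0,\tfrac1n]$ and $I^n_i=(\tfrac{i-1}n,\tfrac in]$ for $2\le i\le n$. Suppose that $u$ reaches consensus, i.e. $\lim_{t\to\infty}\operatorname{ess\,sup}_{(x,y)\in[0,1]^2}|u(x,t)-u(y,t)|=0$. Then for every $\varepsilon>0$ there is $T=T(\varepsilon)>0$ such that for all $D>0$ and $c>0$ there are measurable sets $S_t\subseteq[0,1]^2$ (deterministic and independent of $n$) with $\lambda(S_t)<c^2$ such that asymptotically almost surely (i.e. with probability tending to $1$ as $n\to\infty$) $$|u_n(x,t)-u_n(y,t)|\le\varepsilon\qquad\text{for all } t\in[T,T+D]\text{ and all }(x,y)\in[0,1]^2\setminus S_t .$$ -/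

import Mathlib

open MeasureTheory ProbabilityTheory Filter Topology
open scoped unitInterval ENNReal

/-- A graphon: a symmetric Borel measurable function `[0,1]² → [0,1]`. -/
structure Graphon where
  toFun : I → I → ℝ
  measurable' : Measurable (Function.uncurry toFun)
  symm' : ∀ x y, toFun x y = toFun y x
  mem_Icc' : ∀ x y, toFun x y ∈ Set.Icc (0 : ℝ) 1

instance : CoeFun Graphon (fun _ => I → I → ℝ) := ⟨Graphon.toFun⟩

/-- `W` is continuous at almost every point of the square `[0,1]²`. -/
def Graphon.AEContinuous (W : Graphon) : Prop :=
  ∀ᵐ p : I × I, ContinuousAt (Function.uncurry W.toFun) p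

/-- The Banach space `L_∞([0,1])`. -/
abbrev LInfty : Type := Lp ℝ ∞ (volume : Measure I)

/-- `u ∈ C¹([0,∞), L_∞([0,1]))` solves the continuum voting model with graphon `W` and initial
condition `g`: `u(0) = g` and `∂u/∂t (x,t) = ∫₀¹ W(x,y) (u(y,t) - u(x,t)) dy` for `t > 0`
(an identity in `L_∞`). -/
structure IsContinuumSolution (W : Graphon) (g : LInfty) (u : ℝ → LInfty) : Prop where
  contDiffOn : ContDiffOn ℝ 1 u (Set.Ici 0)
  init : u 0 = g
  eqn : ∀ t : ℝ, 0 < t → ∀ᵐ x : I, (deriv u t) x = ∫ y : I, W x y * ((u t) y - (u t) x)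

/-- Consensus on `[0,1]`: the essential supremum over `(x,y) ∈ [0,1]²` of `|u(x,t) - u(y,t)|`
tends to `0` as `t → ∞`. -/
def ReachesConsensus (u : ℝ → LInfty) : Prop :=
  Tendsto (fun t : ℝ => essSup (fun p : I × I => ‖(u t) p.1 - (u t) p.2‖ₑ) volume) atTop (𝓝 0)

/-- The positivity condition: for some `T₀ > 0`, the (continuous) function
`t ↦ ∫ (u(y,t) - u(x,t))² W(x,y) (1 - W(x,y)) dx dy` is positive on the compact interval
`[0,T₀]`, i.e. has a positive minimum there. -/
def PositivityCondition (W : Graphon) (u : ℝ → LInfty) : Prop :=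
  ∃ T₀ : ℝ, 0 < T₀ ∧ ∀ t ∈ Set.Icc (0 : ℝ) T₀,
    0 < ∫ p : I × I, ((u t) p.2 - (u t) p.1) ^ 2 * W p.1 p.2 * (1 - W p.1 p.2)

/-- The label `i/n ∈ [0,1]` of the `i`-th vertex, `i = 1, …, n`; an index `i : Fin n` stands for
the vertex `i + 1` of `[n]`. -/
noncomputable def gridPoint (n : ℕ) (i : Fin n) : I :=
  Set.projIcc (0 : ℝ) 1 zero_le_one (((i : ℕ) + 1 : ℝ) / n)

/-- The cell of the `i`-th vertex of `[n]`: `[0, 1/n]` for the first one and `((i-1)/n, i/n]` for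
the others. -/
def cell (n : ℕ) (i : Fin n) : Set I :=
  {x : I | (((i : ℕ) : ℝ) / n < x ∨ (i : ℕ) = 0) ∧ (x : ℝ) ≤ ((i : ℕ) + 1 : ℝ) / n}

/-- The discretised initial condition: the vector of the averages of `g` over the cells. -/
noncomputable def discretize (g : LInfty) (n : ℕ) (i : Fin n) : ℝ :=
  n * ∫ x in cell n i, g x

/-- The step function on `[0,1]` with value `a i` on the cell of the `i`-th vertex. -/
noncomputable def stepFun {n : ℕ} (a : Fin n → ℝ) (x : I) : ℝ :=
  ∑ i : Fin n, (cell n i).indicator (fun _ => a i) x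

/-- `v` solves the finite voting model on `[n]` with edge weights `β` and initial opinions `a`. -/
structure IsFiniteSolution {n : ℕ} (β : Fin n → Fin n → ℝ) (a : Fin n → ℝ)
    (v : ℝ → Fin n → ℝ) : Prop where
  continuousOn : ContinuousOn v (Set.Ici 0)
  init : v 0 = a
  eqn : ∀ t : ℝ, 0 < t → ∀ i : Fin n,
    HasDerivAt (fun s => v s i) ((1 / (n : ℝ)) * ∑ j : Fin n, β i j * (v t j - v t i)) t

open Classical in
/-- The 0-1 edge weights of a simple graph. -/
noncomputable def edgeWeight {n : ℕ} (G : SimpleGraph (Fin n)) (i j : Fin n) : ℝ :=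
  if G.Adj i j then 1 else 0

/-- `G` is a `W`-random graph on `[n]` (defined on the probability space `(Ω, P)`): the pairs
`{i,j}` are edges independently, with probability `W(i/n, j/n)`. -/
structure IsWRandomGraph {Ω : Type*} [MeasurableSpace Ω] (P : Measure Ω) (W : Graphon) (n : ℕ)
    (G : Ω → SimpleGraph (Fin n)) : Prop where
  measurableSet_adj : ∀ i j : Fin n, MeasurableSet {ω | (G ω).Adj i j}
  prob_adj : ∀ i j : Fin n, i ≠ j →
    P {ω | (G ω).Adj i j} = ENNReal.ofReal (W (gridPoint n i) (gridPoint n j))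
  indep : iIndepSet
    (fun e : {p : Fin n × Fin n // p.1 < p.2} => {ω | (G ω).Adj e.1.1 e.1.2}) P

/-- The events `A n` hold asymptotically almost surely: `P[A n] → 1` as `n → ∞`. -/
def AsymptoticallyAlmostSurely {Ω : ℕ → Type*} [∀ n, MeasurableSpace (Ω n)]
    (P : ∀ n, Measure (Ω n)) (A : ∀ n, Set (Ω n)) : Prop :=
  Tendsto (fun n => P n (A n)) atTop (𝓝 1)

/-!
The finite solution `v` is compared directly with the continuum solution `u`, in the supremum norm
off a small deterministic exceptional set `E ⊆ [0,1]`.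

Let `e = stepFun v - u`. Its time derivative is, with `β` the edge weights and `Wₙ` the
discretised graphon, both viewed as step functions on the square,
`∫ β(x,y) (e(y) - e(x)) dy + ∫ (β - Wₙ)(x,y) (u(y) - u(x)) dy + ∫ (Wₙ - W)(x,y) (u(y) - u(x)) dy`.
Off `E`, the first term is at most twice the norm of `e` off `E`, up to a multiple of the measure of
`E`, because `e` is bounded (`norm_restrict_finiteField_sub_le`). So Grönwall's inequality
(`norm_restrict_solution_sub_le`) makes `e` small off `E`, uniformly on a compact time interval,
once the other two terms and the initial error are small.

* The second term is a combination of row sums `n⁻¹ ∑ⱼ (βᵢⱼ - Wᵢⱼ) aⱼ`, where `a` is the vector of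
  cell averages of `u(t)` or of `1`. Hoeffding's inequality and a union bound over the rows and over
  a finite net of the compact set of all `u(t)` control it with probability tending to `1`
  (`tendsto_measure_forall_row_sum_le`).
* The third term and the initial error tend to `0` at almost every `x`, by almost everywhere
  continuity of `W` and by Lebesgue differentiation. Egorov's theorem provides a set `E`, independent
  of `n`, off which they do so uniformly (`exists_uniform_approximation`).

The exceptional set is required to serve all `n` and all outcomes at once. For this, `E` is enlarged
by the null set `negligibleCells E`. Two points `x`, `y` outside the enlarged set lie in cells that
both meet the complement of `E` in positive measure, so the values of the step function at `x` and
`y` are also its values at generic points of these cells off `E`, where they are close to those of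
`u`, which is near consensus (`abs_stepFun_sub_le`).
-/

/-! ### The partition of `[0,1]` into cells -/

/-- The index of the cell of `[0,1]` that contains `x`. Truncated subtraction puts `x = 0` into the
first cell. -/
noncomputable def cellIndex (n : ℕ) [NeZero n] (x : I) : Fin n :=
  ⟨⌈(n : ℝ) * x⌉₊ - 1, by
    have hn : 0 < n := Nat.pos_of_neZero n
    have h : ⌈(n : ℝ) * x⌉₊ ≤ n := by
      rw [Nat.ceil_le]
      exact mul_le_of_le_one_right (Nat.cast_nonneg n) x.2.2
    omega⟩

lemma mem_cell_iff {n : ℕ} [NeZero n] (i : Fin n) (x : I) :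
    x ∈ cell n i ↔ cellIndex n x = i := by
  have hn : (0 : ℝ) < n := Nat.cast_pos.2 (Nat.pos_of_neZero n)
  have hx0 : (0 : ℝ) ≤ x := x.2.1
  rw [Fin.ext_iff]
  simp only [cell, cellIndex, Set.mem_ofPred_eq]
  rw [div_lt_iff₀' hn, le_div_iff₀' hn, ← Nat.lt_ceil]
  have h2 : (n : ℝ) * x ≤ (i : ℕ) + 1 ↔ ⌈(n : ℝ) * x⌉₊ ≤ (i : ℕ) + 1 := by
    rw [Nat.ceil_le]; push_cast; rfl
  rw [h2]
  omega

lemma mem_cell_cellIndex (n : ℕ) [NeZero n] (x : I) : x ∈ cell n (cellIndex n x) :=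
  (mem_cell_iff _ _).2 rfl

lemma measurableSet_cell (n : ℕ) (i : Fin n) : MeasurableSet (cell n i) := by
  unfold cell
  refine MeasurableSet.inter (MeasurableSet.union ?_ (MeasurableSet.const _)) ?_
  · exact measurableSet_lt measurable_const measurable_subtype_coe
  · exact measurableSet_le measurable_subtype_coe measurable_const

lemma measurable_cellIndex (n : ℕ) [NeZero n] : Measurable (cellIndex n) :=
  measurable_to_countable' fun i => by
    have : cellIndex n ⁻¹' {i} = cell n i := by
      ext x; simp [mem_cell_iff]
    rw [this]; exact measurableSet_cell n i

lemma stepFun_eq {n : ℕ} [NeZero n] (a : Fin n → ℝ) (x : I) : stepFun a x = a (cellIndex n x) := by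
  classical
  unfold stepFun
  rw [Finset.sum_eq_single (cellIndex n x)]
  · rw [Set.indicator_of_mem (mem_cell_cellIndex n x)]
  · intro i _ hi
    exact Set.indicator_of_notMem (fun h => hi ((mem_cell_iff _ _).1 h).symm) _
  · simp

lemma measurable_stepFun {n : ℕ} (a : Fin n → ℝ) : Measurable (stepFun a) := by
  unfold stepFun
  exact Finset.measurable_sum _ fun i _ => measurable_const.indicator (measurableSet_cell n i)

lemma image_cell_ae_eq {n : ℕ} [NeZero n] (i : Fin n) :
    (Subtype.val '' cell n i : Set ℝ) =ᵐ[volume]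
      Metric.closedBall ((2 * (i : ℕ) + 1) / (2 * n) : ℝ) (1 / (2 * n)) := by
  have hn : (0 : ℝ) < n := Nat.cast_pos.2 (Nat.pos_of_neZero n)
  have hi : ((i : ℕ) : ℝ) + 1 ≤ n := by exact_mod_cast i.2
  rw [Real.closedBall_eq_Icc]
  have e1 : ((2 * (i : ℕ) + 1) / (2 * n) - 1 / (2 * n) : ℝ) = (i : ℕ) / n := by field_simp; ring
  have e2 : ((2 * (i : ℕ) + 1) / (2 * n) + 1 / (2 * n) : ℝ) = ((i : ℕ) + 1) / n := by
    field_simp; ring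
  rw [e1, e2]
  have h1 : (Set.Ioc ((i : ℕ) / n : ℝ) (((i : ℕ) + 1) / n)) ⊆ Subtype.val '' cell n i := by
    intro r hr
    have hr0 : 0 ≤ r := le_trans (by positivity) hr.1.le
    have hr1 : r ≤ 1 := hr.2.trans ((div_le_one hn).2 hi)
    exact ⟨⟨r, hr0, hr1⟩, ⟨Or.inl hr.1, hr.2⟩, rfl⟩
  have h2 : Subtype.val '' cell n i ⊆ (Set.Icc ((i : ℕ) / n : ℝ) (((i : ℕ) + 1) / n)) := by
    rintro _ ⟨x, ⟨hx | hx, hx'⟩, rfl⟩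
    · exact ⟨hx.le, hx'⟩
    · exact ⟨by simpa [hx] using x.2.1, hx'⟩
  refine Filter.EventuallyLE.antisymm h2.eventuallyLE ?_
  exact Ioc_ae_eq_Icc.symm.le.trans h1.eventuallyLE

lemma volume_real_cell {n : ℕ} [NeZero n] (i : Fin n) :
    (volume : Measure I).real (cell n i) = 1 / n := by
  have hn : (0 : ℝ) < n := Nat.cast_pos.2 (Nat.pos_of_neZero n)
  rw [measureReal_def, unitInterval.volume_apply, measure_congr (image_cell_ae_eq i),
    Real.volume_closedBall, ENNReal.toReal_ofReal (by positivity)]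
  field_simp

/-- Integrating against a function of the cell index reduces to integrals over the cells. -/
lemma integral_cellIndex_mul {n : ℕ} [NeZero n] (b : Fin n → ℝ) {h : I → ℝ} (hh : Integrable h) :
    ∫ y, b (cellIndex n y) * h y = ∑ j, b j * ∫ y in cell n j, h y := by
  have : ∀ y, b (cellIndex n y) * h y = ∑ j, b j * (cell n j).indicator h y := by
    intro y
    rw [Finset.sum_eq_single (cellIndex n y)]
    · rw [Set.indicator_of_mem (mem_cell_cellIndex n y)]
    · intro i _ hi
      rw [Set.indicator_of_notMem (fun h => hi ((mem_cell_iff _ _).1 h).symm), mul_zero]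
    · simp
  simp_rw [this]
  rw [integral_finsetSum _ fun j _ => (hh.indicator (measurableSet_cell n j)).const_mul _]
  refine Finset.sum_congr rfl fun j _ => ?_
  rw [integral_const_mul, integral_indicator (measurableSet_cell n j)]

lemma integral_cellIndex {n : ℕ} [NeZero n] (b : Fin n → ℝ) :
    ∫ y : I, b (cellIndex n y) = (1 / (n : ℝ)) * ∑ j, b j := by
  have := integral_cellIndex_mul b (h := fun _ => (1 : ℝ)) (integrable_const _)
  simp only [mul_one, integral_const, measureReal_restrict_apply_univ, volume_real_cell,
    smul_eq_mul] at this
  rw [this, ← Finset.sum_mul, mul_comm]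

/-! ### Bounded functions -/

lemma LInfty.ae_abs_le {μ : Measure I} (f : Lp ℝ ∞ μ) : ∀ᵐ x ∂μ, |f x| ≤ ‖f‖ := by
  filter_upwards [ae_le_eLpNormEssSup (f := f) (μ := μ)] with x hx
  rw [Lp.norm_def, eLpNorm_exponent_top, ← Real.norm_eq_abs, ← toReal_enorm]
  refine ENNReal.toReal_mono ?_ hx
  rw [← eLpNorm_exponent_top]
  exact Lp.eLpNorm_ne_top f

lemma LInfty.norm_le {s : Set I} (f : Lp ℝ ∞ ((volume : Measure I).restrict s)) {C : ℝ}
    (hC : 0 ≤ C) (h : ∀ᵐ x ∂(volume.restrict s), |f x| ≤ C) : ‖f‖ ≤ C := by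
  simpa using Lp.norm_le_of_ae_bound (f := f) hC h

lemma LInfty.integrable (f : LInfty) : Integrable f :=
  (Lp.memLp f).integrable le_top

lemma abs_discretize_le {n : ℕ} [NeZero n] (f : LInfty) (i : Fin n) : |discretize f n i| ≤ ‖f‖ := by
  have hn : (0 : ℝ) < n := Nat.cast_pos.2 (Nat.pos_of_neZero n)
  have h := norm_setIntegral_le_of_norm_le_const_ae' (μ := (volume : Measure I)) (s := cell n i)
    (f := f) (C := ‖f‖) (measure_lt_top _ _)
    (by filter_upwards [LInfty.ae_abs_le f] with x hx _ using hx)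
  rw [volume_real_cell, Real.norm_eq_abs] at h
  rw [discretize, abs_mul, abs_of_pos hn]
  calc (n : ℝ) * _ ≤ n * (‖f‖ * (1 / n)) := by gcongr
    _ = ‖f‖ := by field_simp

lemma discretize_sub {n : ℕ} (f g : LInfty) (i : Fin n) :
    discretize (f - g) n i = discretize f n i - discretize g n i := by
  unfold discretize
  rw [← mul_sub, ← integral_sub (LInfty.integrable f).integrableOn
    (LInfty.integrable g).integrableOn]
  congr 1
  exact integral_congr_ae (ae_restrict_of_ae (Lp.coeFn_sub f g))

/-- The constant function `1`, as an element of `L_∞([0,1])`. -/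
noncomputable def oneLInfty : LInfty := Lp.const ∞ volume 1

lemma discretize_one {n : ℕ} [NeZero n] (i : Fin n) : discretize oneLInfty n i = 1 := by
  have hn : (n : ℝ) ≠ 0 := Nat.cast_ne_zero.2 (NeZero.ne n)
  have : ∫ x in cell n i, oneLInfty x = ∫ x in cell n i, (1 : ℝ) :=
    integral_congr_ae (ae_restrict_of_ae
      (Lp.coeFn_const (p := ∞) (μ := (volume : Measure I)) (1 : ℝ)))
  rw [discretize, this]
  simp [volume_real_cell, hn]

/-! ### Convergence of the discretised data -/

/-- Lebesgue differentiation along the cells: the averages of `g` over the cells containing `x`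
converge to `g x` for almost every `x`. -/
lemma ae_tendsto_stepFun_discretize (g : LInfty) :
    ∀ᵐ x : I, Tendsto (fun n => stepFun (discretize g n) x) atTop (𝓝 (g x)) := by
  set G : ℝ → ℝ := Set.indicator I (fun r => g (Set.projIcc 0 1 zero_le_one r)) with hG
  have hemb : MeasurableEmbedding (Subtype.val : I → ℝ) :=
    MeasurableEmbedding.subtype_coe measurableSet_Icc
  have hGval : ∀ x : I, G x = g x := fun x => by
    rw [hG, Set.indicator_of_mem x.2, Set.projIcc_val]
  have hGint : Integrable G := by
    rw [hG, integrable_indicator_iff measurableSet_Icc, IntegrableOn,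
      ← unitInterval.measurePreserving_coe.integrable_comp_emb hemb]
    refine (LInfty.integrable g).congr (ae_of_all _ fun x => ?_)
    simp [Set.projIcc_val]
  have key := (IsUnifLocDoublingMeasure.ae_tendsto_average (volume : Measure ℝ)
    hGint.locallyIntegrable 1)
  have key' : ∀ᵐ x : I, ∀ (w δ : ℕ → ℝ), Tendsto δ atTop (𝓝[>] 0) →
      (∀ᶠ n in atTop, (x : ℝ) ∈ Metric.closedBall (w n) (1 * δ n)) →
      Tendsto (fun n => ⨍ y in Metric.closedBall (w n) (δ n), G y) atTop (𝓝 (G x)) := by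
    have h1 := ae_restrict_of_ae (s := (I : Set ℝ)) key
    rw [← unitInterval.measurePreserving_coe.map_eq] at h1
    filter_upwards [ae_of_ae_map measurable_subtype_coe.aemeasurable h1] with x hx w δ hδ hw
    exact hx w δ hδ hw
  filter_upwards [key'] with x hx
  have hδ : Tendsto (fun n : ℕ => (1 / (2 * n) : ℝ)) atTop (𝓝[>] 0) := by
    rw [tendsto_nhdsWithin_iff]
    refine ⟨?_, ?_⟩
    · simp_rw [one_div, mul_inv]
      simpa using (tendsto_inv_atTop_nhds_zero_nat (𝕜 := ℝ)).const_mul (2⁻¹ : ℝ)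
    · filter_upwards [eventually_gt_atTop 0] with n hn
      have : (0 : ℝ) < n := Nat.cast_pos.2 hn
      exact Set.mem_Ioi.2 (by positivity)
  -- up to a null set, the cell containing `x` is the ball with this centre and radius
  have h := hx (fun n => (2 * ((⌈(n : ℝ) * x⌉₊ - 1 : ℕ) : ℝ) + 1) / (2 * n))
    (fun n => 1 / (2 * n)) hδ ?_
  · rw [hGval] at h
    refine h.congr' ?_
    filter_upwards [eventually_gt_atTop 0] with n hn
    have : NeZero n := ⟨hn.ne'⟩
    have hn' : (0 : ℝ) < n := Nat.cast_pos.2 hn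
    have hi : ((⌈(n : ℝ) * x⌉₊ - 1 : ℕ) : ℝ) = ((cellIndex n x : ℕ) : ℝ) := rfl
    rw [stepFun_eq, hi, discretize, setAverage_eq, measureReal_def, Real.volume_closedBall,
      ENNReal.toReal_ofReal (by positivity), ← setIntegral_congr_set (image_cell_ae_eq _)]
    rw [smul_eq_mul]
    congr 1
    · field_simp
    · have hsub : Subtype.val '' cell n (cellIndex n x) ⊆ (I : Set ℝ) := by
        rintro _ ⟨y, _, rfl⟩; exact y.2
      rw [← Set.inter_eq_left.2 hsub, ← Measure.restrict_restrict
        (hemb.measurableSet_image.2 (measurableSet_cell n _)),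
        unitInterval.measurePreserving_coe.setIntegral_image_emb hemb]
      exact integral_congr_ae (ae_of_all _ hGval)
  · filter_upwards [eventually_gt_atTop 0] with n hn
    have : NeZero n := ⟨hn.ne'⟩
    have hn' : (0 : ℝ) < n := Nat.cast_pos.2 hn
    have hi : ((⌈(n : ℝ) * x⌉₊ - 1 : ℕ) : ℝ) = ((cellIndex n x : ℕ) : ℝ) := rfl
    obtain ⟨h1, h2⟩ := mem_cell_cellIndex n x
    have h1' : ((cellIndex n x : ℕ) : ℝ) / n ≤ x := by
      rcases h1 with h1 | h1
      · exact h1.le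
      · rw [h1]; simpa using x.2.1
    rw [hi, Real.closedBall_eq_Icc]
    constructor
    · refine le_trans (le_of_eq ?_) h1'
      field_simp; ring
    · refine h2.trans (le_of_eq ?_)
      field_simp; ring

/-- The right end of the cell of the partition into `n` cells that contains `x`, for `n ≥ 1`. -/
noncomputable def cellEnd (n : ℕ) (x : I) : I :=
  Set.projIcc (0 : ℝ) 1 zero_le_one ((((⌈(n : ℝ) * x⌉₊ - 1 : ℕ) : ℝ) + 1) / n)

lemma cellEnd_eq {n : ℕ} [NeZero n] (x : I) : cellEnd n x = gridPoint n (cellIndex n x) := rfl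

lemma measurable_cellEnd (n : ℕ) : Measurable (cellEnd n) := by
  rcases Nat.eq_zero_or_pos n with rfl | hn
  · have : cellEnd 0 = fun _ => Set.projIcc (0 : ℝ) 1 zero_le_one 0 := by
      funext x; simp [cellEnd]
    rw [this]; exact measurable_const
  · have : NeZero n := ⟨hn.ne'⟩
    have h : Measurable (fun i : Fin n => gridPoint n i) := measurable_of_countable _
    have e : cellEnd n = fun x => gridPoint n (cellIndex n x) := rfl
    rw [e]
    exact h.comp (measurable_cellIndex n)

lemma tendsto_cellEnd (x : I) : Tendsto (fun n => cellEnd n x) atTop (𝓝 x) := by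
  rw [tendsto_iff_dist_tendsto_zero]
  refine squeeze_zero' (Eventually.of_forall fun _ => dist_nonneg) ?_
    tendsto_one_div_atTop_nhds_zero_nat
  filter_upwards [eventually_gt_atTop 0] with n hn
  have : NeZero n := ⟨hn.ne'⟩
  have hn' : (0 : ℝ) < n := Nat.cast_pos.2 hn
  obtain ⟨h1, h2⟩ := mem_cell_cellIndex n x
  have h1' : ((cellIndex n x : ℕ) : ℝ) / n ≤ x := by
    rcases h1 with h1 | h1
    · exact h1.le
    · rw [h1]; simpa using x.2.1
  have hi : ((cellIndex n x : ℕ) : ℝ) + 1 ≤ n := by exact_mod_cast (cellIndex n x).2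
  have hmem : (((cellIndex n x : ℕ) : ℝ) + 1) / n ∈ I := ⟨by positivity, (div_le_one hn').2 hi⟩
  rw [cellEnd_eq, gridPoint, Set.projIcc_of_mem _ hmem, Subtype.dist_eq, Real.dist_eq, abs_le]
  simp only [add_div] at h2 ⊢
  have : 0 < 1 / (n : ℝ) := by positivity
  constructor <;> linarith

lemma Graphon.abs_sub_le_one (W : Graphon) (x y x' y' : I) : |W x y - W x' y'| ≤ 1 := by
  have h1 := W.mem_Icc' x y
  have h2 := W.mem_Icc' x' y'
  rw [abs_le]; constructor <;> linarith [h1.1, h1.2, h2.1, h2.2]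

lemma Graphon.measurable_cellEnd_sub (W : Graphon) (n : ℕ) :
    Measurable (fun p : I × I => |W (cellEnd n p.1) (cellEnd n p.2) - W p.1 p.2|) := by
  have h1 : Measurable (fun p : I × I => W (cellEnd n p.1) (cellEnd n p.2)) :=
    W.measurable'.comp (((measurable_cellEnd n).comp measurable_fst).prodMk
      ((measurable_cellEnd n).comp measurable_snd))
  exact (h1.sub W.measurable').abs

/-- For a graphon that is continuous almost everywhere, the rows of its discretisations converge
in `L¹` to the row of the graphon, for almost every row. -/
lemma Graphon.AEContinuous.ae_tendsto_integral {W : Graphon} (hW : W.AEContinuous) :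
    ∀ᵐ x : I, Tendsto (fun n => ∫ y, |W (cellEnd n x) (cellEnd n y) - W x y|) atTop (𝓝 0) := by
  have h := Measure.ae_ae_of_ae_prod hW
  filter_upwards [h] with x hx
  have := tendsto_integral_of_dominated_convergence (μ := (volume : Measure I))
    (F := fun n y => |W (cellEnd n x) (cellEnd n y) - W x y|) (f := fun _ => 0) (fun _ => 1)
    (fun n => ((W.measurable_cellEnd_sub n).comp measurable_prodMk_left).aestronglyMeasurable)
    (integrable_const _) (fun n => ae_of_all _ fun y => by
      rw [Real.norm_eq_abs, abs_abs]; exact W.abs_sub_le_one _ _ _ _)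
    (by
      filter_upwards [hx] with y hy
      have h2 : Tendsto (fun n => W (cellEnd n x) (cellEnd n y)) atTop (𝓝 (W x y)) :=
        hy.tendsto.comp ((tendsto_cellEnd x).prodMk_nhds (tendsto_cellEnd y))
      simpa using (h2.sub_const (W x y)).abs)
  simpa using this

/-- By Egorov's theorem, off a set of small measure the discretised initial data and the rows of
the discretised graphon converge uniformly. -/
lemma exists_uniform_approximation {W : Graphon} (hW : W.AEContinuous) (g : LInfty) {κ : ℝ}
    (hκ : 0 < κ) : ∃ E : Set I, MeasurableSet E ∧ volume E ≤ ENNReal.ofReal κ ∧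
      ∀ η : ℝ, 0 < η → ∀ᶠ n in atTop,
        (∀ᵐ x ∂(volume.restrict Eᶜ), |stepFun (discretize g n) x - g x| ≤ η) ∧
        ∀ x ∉ E, ∫ y, |W (cellEnd n x) (cellEnd n y) - W x y| ≤ η := by
  obtain ⟨g', hg'm, hg'⟩ := (Lp.aestronglyMeasurable g)
  have hmeas : ∀ n, StronglyMeasurable (fun x => |stepFun (discretize g n) x - g' x| +
      ∫ y, |W (cellEnd n x) (cellEnd n y) - W x y|) := fun n =>
    (((measurable_stepFun _).sub hg'm.measurable).abs.stronglyMeasurable).add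
      ((W.measurable_cellEnd_sub n).stronglyMeasurable.integral_prod_right)
  have hlim : ∀ᵐ x : I, Tendsto (fun n => |stepFun (discretize g n) x - g' x| +
      ∫ y, |W (cellEnd n x) (cellEnd n y) - W x y|) atTop (𝓝 0) := by
    filter_upwards [ae_tendsto_stepFun_discretize g, hW.ae_tendsto_integral, hg'] with x h1 h2 h3
    rw [h3] at h1
    simpa using ((h1.sub_const (g' x)).abs).add h2
  obtain ⟨E, hE, hEκ, hunif⟩ :=
    tendstoUniformlyOn_of_ae_tendsto' hmeas stronglyMeasurable_const hlim hκ
  refine ⟨E, hE, hEκ, fun η hη => ?_⟩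
  filter_upwards [Metric.tendstoUniformlyOn_iff.1 hunif η hη] with n hn
  have hbd : ∀ x ∉ E, |stepFun (discretize g n) x - g' x| +
      ∫ y, |W (cellEnd n x) (cellEnd n y) - W x y| ≤ η := fun x hx => by
    have := hn x hx
    rw [dist_zero_left, Real.norm_eq_abs] at this
    exact (le_abs_self _).trans this.le
  have hnn : ∀ x, 0 ≤ ∫ y, |W (cellEnd n x) (cellEnd n y) - W x y| := fun x =>
    integral_nonneg fun _ => abs_nonneg _
  refine ⟨?_, fun x hx => ?_⟩
  · filter_upwards [ae_restrict_mem hE.compl, ae_restrict_of_ae hg'] with x hx hx'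
    rw [hx']
    linarith [hbd x hx, hnn x]
  · linarith [hbd x hx, abs_nonneg (stepFun (discretize g n) x - g' x)]

/-! ### Fluctuations of the row sums of the random graph -/

lemma edgeWeight_mem_Icc {n : ℕ} (G : SimpleGraph (Fin n)) (i j : Fin n) :
    edgeWeight G i j ∈ Set.Icc (0 : ℝ) 1 := by
  unfold edgeWeight; split_ifs <;> simp

lemma edgeWeight_eq_indicator {n : ℕ} {Ω : Type*} (G : Ω → SimpleGraph (Fin n)) (i j : Fin n)
    (ω : Ω) : edgeWeight (G ω) i j = {ω | (G ω).Adj i j}.indicator (fun _ => (1 : ℝ)) ω := by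
  classical
  simp [edgeWeight, Set.indicator_apply]

namespace IsWRandomGraph

variable {Ω : Type*} [MeasurableSpace Ω] {P : Measure Ω} {W : Graphon} {n : ℕ}
  {G : Ω → SimpleGraph (Fin n)}

lemma measurable_edgeWeight (hG : IsWRandomGraph P W n G) (i j : Fin n) :
    Measurable (fun ω => edgeWeight (G ω) i j) := by
  simp_rw [edgeWeight_eq_indicator]
  exact measurable_const.indicator (hG.measurableSet_adj i j)

lemma integral_edgeWeight (hG : IsWRandomGraph P W n G) {i j : Fin n} (hij : i ≠ j) :
    ∫ ω, edgeWeight (G ω) i j ∂P = W (gridPoint n i) (gridPoint n j) := by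
  simp_rw [edgeWeight_eq_indicator]
  rw [integral_indicator (hG.measurableSet_adj i j)]
  simp [measureReal_def, hG.prob_adj i j hij, (W.mem_Icc' _ _).1]

/-- The edges at a fixed vertex are independent. -/
lemma iIndepFun_row (hG : IsWRandomGraph P W n G) (i : Fin n) :
    iIndepFun (fun (j : {j : Fin n // j ≠ i}) ω => edgeWeight (G ω) i j) P := by
  let e : {j : Fin n // j ≠ i} → {p : Fin n × Fin n // p.1 < p.2} := fun j =>
    ⟨(min i j, max i j), min_lt_max.2 j.2.symm⟩
  have he : Function.Injective e := by
    rintro ⟨j, hj⟩ ⟨k, hk⟩ h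
    have h1 : min i j = min i k := congrArg (fun p => p.1.1) h
    have h2 : max i j = max i k := congrArg (fun p => p.1.2) h
    apply Subtype.ext
    simp only
    grind
  have h := (hG.indep.precomp he).iIndepFun_indicator (β := ℝ) (m := inferInstance)
  have heq : (fun (j : {j : Fin n // j ≠ i}) => Set.indicator
      (((fun e : {p : Fin n × Fin n // p.1 < p.2} => {ω | (G ω).Adj e.1.1 e.1.2}) ∘ e) j)
      (fun _ => (1 : ℝ))) = fun (j : {j : Fin n // j ≠ i}) ω => edgeWeight (G ω) i j := by
    funext j ω
    rw [edgeWeight_eq_indicator]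
    congr 1
    ext ω
    change (G ω).Adj (min i j) (max i j) ↔ (G ω).Adj i j
    rcases le_total i j with hle | hle
    · rw [min_eq_left hle, max_eq_right hle]
    · rw [min_eq_right hle, max_eq_left hle, SimpleGraph.adj_comm]
  rw [← heq]
  exact h

/-- Hoeffding's inequality for a weighted row sum. -/
lemma measureReal_row_sum_ge_le [IsProbabilityMeasure P] (hG : IsWRandomGraph P W n G)
    (hn : 2 ≤ n) (i : Fin n) {a : Fin n → ℝ} {M : ℝ} (hM : 0 < M) (ha : ∀ j, |a j| ≤ M) {r : ℝ}
    (hr : 0 ≤ r) :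
    P.real {ω | r ≤ ∑ j : {j : Fin n // j ≠ i},
      (edgeWeight (G ω) i j - W (gridPoint n i) (gridPoint n j)) * a j} ≤
      Real.exp (-r ^ 2 / (2 * (n * M ^ 2))) := by
  have hindep : iIndepFun (fun (j : {j : Fin n // j ≠ i}) ω =>
      (edgeWeight (G ω) i j - W (gridPoint n i) (gridPoint n j)) * a j) P :=
    (hG.iIndepFun_row i).comp
      (fun j b => (b - W (gridPoint n i) (gridPoint n j)) * a j) (fun j => by fun_prop)
  have hsub : ∀ j ∈ (Finset.univ : Finset {j : Fin n // j ≠ i}), HasSubgaussianMGF (fun ω =>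
      (edgeWeight (G ω) i j - W (gridPoint n i) (gridPoint n j)) * a j)
      ((‖M - -M‖₊ / 2) ^ 2) P := by
    intro j _
    have h := hasSubgaussianMGF_of_mem_Icc (μ := P) (X := fun ω => edgeWeight (G ω) i j * a j)
      (a := -M) (b := M) ((hG.measurable_edgeWeight i j).mul_const _).aemeasurable
      (ae_of_all _ fun ω => by
        rw [Set.mem_Icc, ← abs_le, abs_mul]
        have h1 := edgeWeight_mem_Icc (G ω) i j
        rw [abs_of_nonneg h1.1]
        calc _ ≤ 1 * M := by gcongr; exacts [h1.2, ha j]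
          _ = M := one_mul M)
    rw [integral_mul_const, hG.integral_edgeWeight j.2.symm] at h
    simpa only [sub_mul] using h
  have h := HasSubgaussianMGF.measure_sum_ge_le_of_iIndepFun hindep hsub hr
  refine h.trans (Real.exp_le_exp.2 ?_)
  have hcard : Fintype.card {j : Fin n // j ≠ i} = n - 1 := by simp
  have hc : (((∑ _j : {j : Fin n // j ≠ i}, (‖M - -M‖₊ / 2) ^ 2 : NNReal)) : ℝ)
      = (n - 1 : ℕ) * M ^ 2 := by
    rw [Finset.sum_const, Finset.card_univ, hcard]
    simp only [nsmul_eq_mul, NNReal.coe_mul, NNReal.coe_natCast, NNReal.coe_pow, NNReal.coe_div,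
      coe_nnnorm, NNReal.coe_ofNat, Real.norm_eq_abs]
    rw [sub_neg_eq_add, abs_of_pos (by positivity), add_self_div_two]
  rw [hc, neg_div, neg_div, neg_le_neg_iff]
  have h1 : (0 : ℝ) < (n - 1 : ℕ) := by exact_mod_cast (by omega : 0 < n - 1)
  gcongr
  omega

/-- With high probability all weighted row sums of the centred adjacency matrix are small. The
diagonal entries, which are not centred because the graph has no loops, contribute at most `M / n`
to each of them; this is absorbed by the condition on `n`. -/
lemma measure_exists_row_sum_gt_le [IsProbabilityMeasure P] (hG : IsWRandomGraph P W n G)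
    (hn : 2 ≤ n) {a : Fin n → ℝ} {M δ : ℝ} (hM : 0 < M) (ha : ∀ j, |a j| ≤ M) (hδ : 0 < δ)
    (hnδ : 2 * M ≤ n * δ) :
    P {ω | ∃ i, δ < |1 / (n : ℝ) *
      ∑ j, (edgeWeight (G ω) i j - W (gridPoint n i) (gridPoint n j)) * a j|} ≤
      ENNReal.ofReal (2 * (n * Real.exp (-(δ ^ 2 / (8 * M ^ 2) * n)))) := by
  have hn0 : (0 : ℝ) < n := by exact_mod_cast (by omega : 0 < n)
  set S : Fin n → Ω → ℝ := fun i ω => ∑ j : {j : Fin n // j ≠ i},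
      (edgeWeight (G ω) i j - W (gridPoint n i) (gridPoint n j)) * a j with hS
  set p : ℝ := Real.exp (-(δ ^ 2 / (8 * M ^ 2) * n)) with hp
  have hexp : Real.exp (-(n * δ / 2) ^ 2 / (2 * (n * M ^ 2))) = p := by
    rw [hp]; congr 1; field_simp; norm_num
  have hpos : ∀ i, P.real {ω | n * δ / 2 ≤ S i ω} ≤ p := fun i => hexp ▸
    hG.measureReal_row_sum_ge_le hn i hM ha (by positivity)
  have hneg : ∀ i, P.real {ω | n * δ / 2 ≤ - S i ω} ≤ p := fun i => by
    have := hG.measureReal_row_sum_ge_le hn i (a := fun j => - a j) hM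
      (fun j => by rw [abs_neg]; exact ha j) (r := n * δ / 2) (by positivity)
    rw [hexp] at this
    simpa only [hS, mul_neg, Finset.sum_neg_distrib] using this
  have hsubset : {ω | ∃ i, δ < |1 / (n : ℝ) *
      ∑ j, (edgeWeight (G ω) i j - W (gridPoint n i) (gridPoint n j)) * a j|} ⊆
      ⋃ i, ({ω | n * δ / 2 ≤ S i ω} ∪ {ω | n * δ / 2 ≤ - S i ω}) := by
    rintro ω ⟨i, hi⟩
    refine Set.mem_iUnion.2 ⟨i, ?_⟩
    have hsplit : ∑ j, (edgeWeight (G ω) i j - W (gridPoint n i) (gridPoint n j)) * a j =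
        S i ω + (edgeWeight (G ω) i i - W (gridPoint n i) (gridPoint n i)) * a i := by
      rw [← Fintype.sum_subtype_add_sum_subtype (fun j => j ≠ i)]
      congr 1
      have hi : ∀ j : {j : Fin n // ¬ j ≠ i}, (j : Fin n) = i := fun j => not_not.1 j.2
      have : Unique {j : Fin n // ¬ j ≠ i} := ⟨⟨⟨i, by simp⟩⟩, fun j => Subtype.ext (hi j)⟩
      rw [Fintype.sum_unique, hi]
    have hdiag : |(edgeWeight (G ω) i i - W (gridPoint n i) (gridPoint n i)) * a i| ≤ M := by
      rw [abs_mul]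
      have h1 := edgeWeight_mem_Icc (G ω) i i
      have h2 := W.mem_Icc' (gridPoint n i) (gridPoint n i)
      have h3 : |edgeWeight (G ω) i i - W (gridPoint n i) (gridPoint n i)| ≤ 1 := by
        rw [abs_le]; constructor <;> linarith [h1.1, h1.2, h2.1, h2.2]
      calc _ ≤ 1 * M := by gcongr; exact ha i
        _ = M := one_mul M
    rw [abs_mul, abs_of_pos (by positivity), hsplit, one_div, ← div_eq_inv_mul,
      lt_div_iff₀ hn0] at hi
    have h4 := abs_add_le (S i ω)
      ((edgeWeight (G ω) i i - W (gridPoint n i) (gridPoint n i)) * a i)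
    have h5 : n * δ / 2 ≤ |S i ω| := by linarith
    exact le_abs.1 h5
  refine (measure_mono hsubset).trans ((measure_iUnion_fintype_le _ _).trans ?_)
  calc ∑ i, P ({ω | n * δ / 2 ≤ S i ω} ∪ {ω | n * δ / 2 ≤ - S i ω})
      ≤ ∑ _i : Fin n, ENNReal.ofReal (2 * p) := by
        refine Finset.sum_le_sum fun i _ => ?_
        rw [← ofReal_measureReal]
        refine ENNReal.ofReal_le_ofReal ((measureReal_union_le _ _).trans ?_)
        linarith [hpos i, hneg i]
    _ = ENNReal.ofReal (2 * (n * p)) := by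
        rw [Finset.sum_const, Finset.card_univ, Fintype.card_fin, nsmul_eq_mul,
          ← ENNReal.ofReal_natCast, ← ENNReal.ofReal_mul (by positivity)]
        ring_nf

end IsWRandomGraph

/-- The probability that some weighted row sum of the centred adjacency matrix is large tends
to `0`, since the union bound over the `n` rows loses only a factor `n` against an exponentially
small probability. -/
lemma tendsto_measure_exists_row_sum_gt {W : Graphon} {Ω : ℕ → Type*}
    [∀ n, MeasurableSpace (Ω n)] {P : ∀ n, Measure (Ω n)} [∀ n, IsProbabilityMeasure (P n)]
    {G : ∀ n, Ω n → SimpleGraph (Fin n)} (hG : ∀ n, IsWRandomGraph (P n) W n (G n))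
    (f : LInfty) {δ : ℝ} (hδ : 0 < δ) :
    Tendsto (fun n => P n {ω | ∃ i, δ < |1 / (n : ℝ) * ∑ j,
      (edgeWeight (G n ω) i j - W (gridPoint n i) (gridPoint n j)) * discretize f n j|})
      atTop (𝓝 0) := by
  set M : ℝ := ‖f‖ + 1 with hM
  have hMpos : 0 < M := by positivity
  have hb : 0 < δ ^ 2 / (8 * M ^ 2) := by positivity
  have hlim : Tendsto (fun n : ℕ => ENNReal.ofReal
      (2 * (n * Real.exp (-(δ ^ 2 / (8 * M ^ 2) * n))))) atTop (𝓝 0) := by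
    have h1 := tendsto_rpow_mul_exp_neg_mul_atTop_nhds_zero 1 _ hb
    have h2 := ((h1.comp tendsto_natCast_atTop_atTop).const_mul 2)
    rw [mul_zero] at h2
    simpa using ENNReal.tendsto_ofReal h2
  refine tendsto_of_tendsto_of_tendsto_of_le_of_le' tendsto_const_nhds hlim
    (Eventually.of_forall fun _ => zero_le) ?_
  have hlarge : ∀ᶠ n : ℕ in atTop, 2 * M / δ ≤ n :=
    tendsto_natCast_atTop_atTop.eventually_ge_atTop _
  filter_upwards [hlarge, eventually_ge_atTop 2] with n h1 h2
  have : NeZero n := ⟨by omega⟩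
  refine (hG n).measure_exists_row_sum_gt_le h2 hMpos (fun j => ?_) hδ ?_
  · exact (abs_discretize_le f j).trans (by linarith)
  · exact (div_le_iff₀ hδ).1 h1

/-- The row sums of the centred adjacency matrix, weighted by the discretisations of the members of
a compact set of functions, are uniformly small asymptotically almost surely. -/
lemma tendsto_measure_forall_row_sum_le {W : Graphon} {Ω : ℕ → Type*}
    [∀ n, MeasurableSpace (Ω n)] {P : ∀ n, Measure (Ω n)} [∀ n, IsProbabilityMeasure (P n)]
    {G : ∀ n, Ω n → SimpleGraph (Fin n)} (hG : ∀ n, IsWRandomGraph (P n) W n (G n))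
    {K : Set LInfty} (hK : IsCompact K) {δ : ℝ} (hδ : 0 < δ) :
    ∃ B : ∀ n, Set (Ω n), Tendsto (fun n => P n (B n)) atTop (𝓝 0) ∧
      ∀ n ≠ 0, ∀ ω ∉ B n, ∀ f ∈ K, ∀ i, |1 / (n : ℝ) * ∑ j,
        (edgeWeight (G n ω) i j - W (gridPoint n i) (gridPoint n j)) * discretize f n j| ≤ δ := by
  obtain ⟨F, hFfin, hF⟩ := Metric.totallyBounded_iff.1 hK.totallyBounded (δ / 2) (half_pos hδ)
  refine ⟨fun n => ⋃ f ∈ hFfin.toFinset, {ω | ∃ i, δ / 2 < |1 / (n : ℝ) * ∑ j,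
      (edgeWeight (G n ω) i j - W (gridPoint n i) (gridPoint n j)) * discretize f n j|}, ?_, ?_⟩
  · have h := tendsto_finsetSum hFfin.toFinset fun f _ =>
      tendsto_measure_exists_row_sum_gt hG f (half_pos hδ)
    rw [Finset.sum_const_zero] at h
    exact tendsto_of_tendsto_of_tendsto_of_le_of_le tendsto_const_nhds h (fun _ => zero_le)
      fun n => measure_biUnion_finset_le _ _
  · intro n hn ω hω f hf i
    have : NeZero n := ⟨hn⟩
    have hn0 : (0 : ℝ) < n := Nat.cast_pos.2 (Nat.pos_of_ne_zero hn)
    obtain ⟨f₀, hf₀, hdist⟩ := Set.mem_iUnion₂.1 (hF hf)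
    rw [mem_ball_iff_norm] at hdist
    have h1 : |1 / (n : ℝ) * ∑ j, (edgeWeight (G n ω) i j -
        W (gridPoint n i) (gridPoint n j)) * discretize f₀ n j| ≤ δ / 2 := by
      by_contra hcon
      exact hω (Set.mem_biUnion (hFfin.mem_toFinset.2 hf₀) ⟨i, not_le.1 hcon⟩)
    have h2 : |1 / (n : ℝ) * ∑ j, (edgeWeight (G n ω) i j -
        W (gridPoint n i) (gridPoint n j)) * discretize (f - f₀) n j| ≤ δ / 2 := by
      rw [abs_mul, abs_of_pos (by positivity), one_div, ← div_eq_inv_mul, div_le_iff₀ hn0]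
      refine (Finset.abs_sum_le_sum_abs _ _).trans ?_
      calc _ ≤ ∑ _j : Fin n, δ / 2 := by
            refine Finset.sum_le_sum fun j _ => ?_
            rw [abs_mul]
            have h1 := edgeWeight_mem_Icc (G n ω) i j
            have h2 := W.mem_Icc' (gridPoint n i) (gridPoint n j)
            have h3 : |edgeWeight (G n ω) i j - W (gridPoint n i) (gridPoint n j)| ≤ 1 := by
              rw [abs_le]; constructor <;> linarith [h1.1, h1.2, h2.1, h2.2]
            calc _ ≤ 1 * (δ / 2) := by
                  gcongr; exact (abs_discretize_le _ j).trans hdist.le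
              _ = δ / 2 := one_mul _
        _ = δ / 2 * n := by simp [mul_comm]
    have h3 : ∀ j, discretize f n j = discretize f₀ n j + discretize (f - f₀) n j := fun j => by
      rw [discretize_sub]; ring
    simp_rw [h3, mul_add, Finset.sum_add_distrib, mul_add]
    exact (abs_add_le _ _).trans (by linarith)

/-! ### Comparison of the finite and the continuum model -/

/-- Grönwall's inequality for a function that is differentiable only in the interior of the
interval. -/
lemma norm_le_gronwallBound_of_hasDerivAt_Ioo {F : Type*} [NormedAddCommGroup F] [NormedSpace ℝ F]
    {f f' : ℝ → F} {K ε b : ℝ} (hK : K ≠ 0) (hf : ContinuousOn f (Set.Icc 0 b))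
    (hf' : ∀ t ∈ Set.Ioo 0 b, HasDerivAt f (f' t) t)
    (bound : ∀ t ∈ Set.Ioo 0 b, ‖f' t‖ ≤ K * ‖f t‖ + ε) {t : ℝ} (ht : t ∈ Set.Icc 0 b) :
    ‖f t‖ ≤ gronwallBound ‖f 0‖ K ε t := by
  rcases ht.1.eq_or_lt with rfl | ht0
  · rw [gronwallBound_x0]
  have h1 : ∀ᶠ a in 𝓝[>] (0 : ℝ), ‖f t‖ ≤ gronwallBound ‖f a‖ K ε (t - a) := by
    filter_upwards [Ioo_mem_nhdsGT ht0] with a ha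
    refine norm_le_gronwallBound_of_norm_deriv_right_le (f' := f') (b := b)
      (hf.mono (Set.Icc_subset_Icc_left ha.1.le)) (fun s hs => ?_) le_rfl (fun s hs => ?_) t
      ⟨ha.2.le, ht.2⟩
    · exact (hf' s ⟨ha.1.trans_le hs.1, hs.2⟩).hasDerivWithinAt
    · exact bound s ⟨ha.1.trans_le hs.1, hs.2⟩
  have hcont : Tendsto f (𝓝[>] (0 : ℝ)) (𝓝 (f 0)) := by
    have h := (hf 0 ⟨le_rfl, ht.1.trans ht.2⟩).mono_left
      (nhdsWithin_le_of_mem (Icc_mem_nhdsGT (ht0.trans_le ht.2)))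
    exact h
  have hid : Tendsto (fun a : ℝ => t - a) (𝓝[>] (0 : ℝ)) (𝓝 t) := by
    have : Tendsto (fun a : ℝ => t - a) (𝓝 (0 : ℝ)) (𝓝 (t - 0)) := by
      apply Continuous.tendsto; fun_prop
    rw [sub_zero] at this
    exact this.mono_left nhdsWithin_le_nhds
  refine ge_of_tendsto ?_ h1
  simp only [gronwallBound_of_K_ne_0 hK]
  have hexp : Tendsto (fun a : ℝ => Real.exp (K * (t - a))) (𝓝[>] (0 : ℝ))
      (𝓝 (Real.exp (K * t))) := (Real.continuous_exp.tendsto _).comp (hid.const_mul K)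
  exact (hcont.norm.mul hexp).add ((hexp.sub_const 1).const_mul _)

/-- The step function with given values, as an element of `L_∞([0,1])` that depends linearly and
continuously on the values. -/
noncomputable def stepCLM (n : ℕ) : (Fin n → ℝ) →L[ℝ] LInfty :=
  ∑ i : Fin n, (ContinuousLinearMap.proj (R := ℝ) (φ := fun _ : Fin n => ℝ) i).smulRight
    (indicatorConstLp ∞ (measurableSet_cell n i) (measure_ne_top volume _) (1 : ℝ))

lemma stepCLM_coeFn {n : ℕ} (a : Fin n → ℝ) : stepCLM n a =ᵐ[volume] stepFun a := by
  classical
  have h1 : stepCLM n a = ∑ i : Fin n,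
      a i • indicatorConstLp ∞ (measurableSet_cell n i) (measure_ne_top volume _) (1 : ℝ) := by
    simp [stepCLM]
  rw [h1]
  have h2 : ∀ i : Fin n, ∀ᵐ x : I, (a i • indicatorConstLp ∞ (measurableSet_cell n i)
      (measure_ne_top volume _) (1 : ℝ) : LInfty) x = (cell n i).indicator (fun _ => a i) x := by
    intro i
    filter_upwards [Lp.coeFn_smul (a i) (indicatorConstLp ∞ (measurableSet_cell n i)
      (measure_ne_top volume _) (1 : ℝ) : LInfty), indicatorConstLp_coeFn (p := ∞)
      (hs := measurableSet_cell n i) (hμs := measure_ne_top volume _) (c := (1 : ℝ))] with x h3 h4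
    rw [h3, Pi.smul_apply, h4]
    by_cases hx : x ∈ cell n i <;> simp [hx]
  filter_upwards [ae_all_iff.2 h2, Lp.coeFn_finsetSum Finset.univ fun i : Fin n =>
    (a i • indicatorConstLp ∞ (measurableSet_cell n i)
      (measure_ne_top volume _) (1 : ℝ) : LInfty)] with x h5 h6
  rw [h6]
  simp [stepFun, h5, Finset.sum_apply]

/-- The right-hand side of the finite voting model. -/
noncomputable def finiteField {n : ℕ} (β : Fin n → Fin n → ℝ) (a : Fin n → ℝ) (i : Fin n) : ℝ :=
  (1 / (n : ℝ)) * ∑ j, β i j * (a j - a i)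

lemma norm_finiteField_le {n : ℕ} {β : Fin n → Fin n → ℝ} (hβ : ∀ i j, β i j ∈ Set.Icc (0 : ℝ) 1)
    (a : Fin n → ℝ) : ‖finiteField β a‖ ≤ 2 * ‖a‖ := by
  refine (pi_norm_le_iff_of_nonneg (by positivity)).2 fun i => ?_
  have hn0 : (0 : ℝ) < n := Nat.cast_pos.2 i.pos
  rw [finiteField, Real.norm_eq_abs, abs_mul, abs_of_pos (by positivity), one_div,
    ← div_eq_inv_mul, div_le_iff₀ hn0]
  refine (Finset.abs_sum_le_sum_abs _ _).trans ?_
  calc _ ≤ ∑ _j : Fin n, 2 * ‖a‖ := by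
        refine Finset.sum_le_sum fun j _ => ?_
        rw [abs_mul, abs_of_nonneg (hβ i j).1]
        have h1 : |a j - a i| ≤ 2 * ‖a‖ := by
          have h2 := norm_le_pi_norm a j
          have h3 := norm_le_pi_norm a i
          rw [Real.norm_eq_abs] at h2 h3
          linarith [abs_sub (a j) (a i)]
        calc _ ≤ 1 * (2 * ‖a‖) := by gcongr; exact (hβ i j).2
          _ = 2 * ‖a‖ := one_mul _
    _ = 2 * ‖a‖ * n := by simp [mul_comm]

namespace IsFiniteSolution

variable {n : ℕ} {β : Fin n → Fin n → ℝ} {a : Fin n → ℝ} {v : ℝ → Fin n → ℝ}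

lemma hasDerivAt (hv : IsFiniteSolution β a v) {t : ℝ} (ht : 0 < t) :
    HasDerivAt v (finiteField β (v t)) t :=
  hasDerivAt_pi.2 fun i => hv.eqn t ht i

lemma norm_le (hv : IsFiniteSolution β a v) (hβ : ∀ i j, β i j ∈ Set.Icc (0 : ℝ) 1) {t b : ℝ}
    (ht : t ∈ Set.Icc 0 b) : ‖v t‖ ≤ ‖a‖ * Real.exp (2 * b) := by
  have h := norm_le_gronwallBound_of_hasDerivAt_Ioo (K := 2) (ε := 0) two_ne_zero
    (hv.continuousOn.mono Set.Icc_subset_Ici_self)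
    (fun s hs => hv.hasDerivAt hs.1)
    (fun s _ => by rw [add_zero]; exact norm_finiteField_le hβ (v s)) ht
  rw [hv.init, gronwallBound_ε0] at h
  refine h.trans ?_
  gcongr
  exact ht.2

end IsFiniteSolution

lemma Graphon.measurable_row (W : Graphon) (x : I) : Measurable (W x) :=
  W.measurable'.comp measurable_prodMk_left

/-- The difference of the right-hand sides of the finite and the continuum model, in the supremum
norm off an exceptional set `E`. It is controlled by the difference of the opinions off `E`, the
measure of `E`, the fluctuations of the random graph and the discretisation error of the
graphon. -/
lemma norm_restrict_finiteField_sub_le {W : Graphon} {n : ℕ} [NeZero n] {β : Fin n → Fin n → ℝ}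
    (hβ : ∀ i j, β i j ∈ Set.Icc (0 : ℝ) 1) {E : Set I} (hE : MeasurableSet E)
    {M κ δ η : ℝ} (hη : 0 ≤ η) (hEκ : volume.real E ≤ κ)
    (hWE : ∀ x ∉ E, ∫ y, |W (cellEnd n x) (cellEnd n y) - W x y| ≤ η)
    {a : Fin n → ℝ} (ha : ‖a‖ ≤ M) {w w' : LInfty} (hw : ‖w‖ ≤ M)
    (hw' : ∀ᵐ x : I, w' x = ∫ y : I, W x y * (w y - w x))
    (h1 : ∀ i, |1 / (n : ℝ) * ∑ j, (β i j - W (gridPoint n i) (gridPoint n j))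
      * discretize oneLInfty n j| ≤ δ)
    (h2 : ∀ i, |1 / (n : ℝ) * ∑ j, (β i j - W (gridPoint n i) (gridPoint n j))
      * discretize w n j| ≤ δ) :
    ‖LpToLpRestrictCLM I ℝ ℝ volume ∞ Eᶜ (stepCLM n (finiteField β a) - w')‖ ≤
      2 * ‖LpToLpRestrictCLM I ℝ ℝ volume ∞ Eᶜ (stepCLM n a - w)‖ +
        (2 * M * κ + (1 + M) * δ + 2 * M * η) := by
  set f := LpToLpRestrictCLM I ℝ ℝ volume ∞ Eᶜ (stepCLM n a - w) with hf
  have hn0 : (0 : ℝ) < n := Nat.cast_pos.2 (Nat.pos_of_neZero n)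
  have hM : 0 ≤ M := (norm_nonneg _).trans ha
  have hκ : 0 ≤ κ := measureReal_nonneg.trans hEκ
  have hδ : 0 ≤ δ := (abs_nonneg _).trans (h1 0)
  set e : I → ℝ := fun y => a (cellIndex n y) - w y with he
  have hwint := LInfty.integrable w
  have hint : ∀ b : Fin n → ℝ, Integrable (fun y : I => b (cellIndex n y)) := fun b =>
    Integrable.of_bound ((measurable_of_countable b).comp
      (measurable_cellIndex n)).aestronglyMeasurable ‖b‖ (ae_of_all _ fun y => norm_le_pi_norm b _)
  have heint : Integrable e := (hint a).sub hwint
  have hwM : ∀ᵐ y : I, |w y| ≤ M := by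
    filter_upwards [LInfty.ae_abs_le w] with y hy using hy.trans hw
  have haM : ∀ i, |a i| ≤ M := fun i => (norm_le_pi_norm a i).trans ha
  have hfe : ∀ᵐ y ∂(volume.restrict Eᶜ), |e y| ≤ ‖f‖ := by
    filter_upwards [LInfty.ae_abs_le f, LpToLpRestrictCLM_coeFn ℝ Eᶜ (stepCLM n a - w),
      ae_restrict_of_ae (Lp.coeFn_sub (stepCLM n a) w), ae_restrict_of_ae (stepCLM_coeFn a)]
      with y h3 h4 h5 h6
    rw [← hf] at h4
    rw [h4, h5, Pi.sub_apply, h6, stepFun_eq] at h3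
    exact h3
  -- the `L¹` norm of the difference is at most its supremum off `E`, plus the contribution of `E`
  have hL1 : ∫ y, |e y| ≤ ‖f‖ + 2 * M * κ := by
    rw [← integral_add_compl hE heint.abs]
    have h3 : ∫ y in E, |e y| ≤ 2 * M * κ := by
      have := norm_setIntegral_le_of_norm_le_const_ae' (μ := (volume : Measure I)) (s := E)
        (f := fun y => |e y|) (C := 2 * M) (measure_lt_top _ _) (by
          filter_upwards [hwM] with y hy _
          rw [Real.norm_eq_abs, abs_abs]
          have := haM (cellIndex n y)
          have := abs_sub (a (cellIndex n y)) (w y)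
          simp only [he]; linarith)
      refine (le_abs_self _).trans (this.trans ?_)
      gcongr
    have h4 : ∫ y in Eᶜ, |e y| ≤ ‖f‖ := by
      have := norm_integral_le_of_norm_le_const (μ := (volume : Measure I).restrict Eᶜ)
        (f := fun y => |e y|) (C := ‖f‖) (by
          filter_upwards [hfe] with y hy; rwa [Real.norm_eq_abs, abs_abs])
      refine (le_abs_self _).trans (this.trans ?_)
      rw [measureReal_restrict_apply_univ]
      exact mul_le_of_le_one_right (norm_nonneg _) measureReal_le_one
    linarith
  refine LInfty.norm_le _ (by positivity) ?_
  filter_upwards [LpToLpRestrictCLM_coeFn ℝ Eᶜ (stepCLM n (finiteField β a) - w'),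
    ae_restrict_of_ae (Lp.coeFn_sub (stepCLM n (finiteField β a)) w'),
    ae_restrict_of_ae (stepCLM_coeFn (finiteField β a)), ae_restrict_of_ae hw',
    ae_restrict_of_ae hwM, hfe, ae_restrict_mem hE.compl] with x h3 h4 h5 h6 h7 h8 h9
  rw [h3, h4, Pi.sub_apply, h5, h6, stepFun_eq]
  set i := cellIndex n x with hi
  set B : I → ℝ := fun y => β i (cellIndex n y) with hB
  set V : I → ℝ := fun y => W (cellEnd n x) (cellEnd n y) with hV
  have hBm : Measurable B := (measurable_of_countable (β i)).comp (measurable_cellIndex n)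
  have hVm : Measurable V := (W.measurable_row _).comp (measurable_cellEnd n)
  have hVW : Measurable fun y => V y - W x y := hVm.sub (W.measurable_row x)
  have hBV : Measurable fun y => B y - V y := hBm.sub hVm
  have hBle : ∀ y, ‖B y‖ ≤ 1 := fun y => by
    rw [Real.norm_eq_abs, abs_of_nonneg (hβ _ _).1]; exact (hβ _ _).2
  have hVWle : ∀ y, ‖V y - W x y‖ ≤ 1 := fun y => W.abs_sub_le_one _ _ _ _
  have hBVle : ∀ y, ‖B y - V y‖ ≤ 1 := fun y => by
    have h1 := hβ i (cellIndex n y)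
    have h2 := W.mem_Icc' (cellEnd n x) (cellEnd n y)
    rw [Real.norm_eq_abs, abs_le]; constructor <;> linarith [h1.1, h1.2, h2.1, h2.2]
  have hdint : Integrable fun y => w y - w x := hwint.sub (integrable_const _)
  have hI1 : Integrable fun y => B y * (e y - e x) :=
    (heint.sub (integrable_const _)).bdd_mul hBm.aestronglyMeasurable (ae_of_all _ hBle)
  have hI2 : Integrable fun y => (B y - V y) * (w y - w x) :=
    hdint.bdd_mul hBV.aestronglyMeasurable (ae_of_all _ hBVle)
  have hI3 : Integrable fun y => (V y - W x y) * (w y - w x) :=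
    hdint.bdd_mul hVW.aestronglyMeasurable (ae_of_all _ hVWle)
  have hI4 : Integrable fun y => W x y * (w y - w x) := by
    refine hdint.bdd_mul (c := 1) (W.measurable_row x).aestronglyMeasurable (ae_of_all _ fun y => ?_)
    rw [Real.norm_eq_abs, abs_of_nonneg (W.mem_Icc' _ _).1]; exact (W.mem_Icc' _ _).2
  have hI5 : Integrable fun y => B y * (a (cellIndex n y) - a i) :=
    ((hint a).sub (integrable_const _)).bdd_mul hBm.aestronglyMeasurable (ae_of_all _ hBle)
  have hfield : finiteField β a i = ∫ y, B y * (a (cellIndex n y) - a i) :=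
    (integral_cellIndex (fun j => β i j * (a j - a i))).symm
  have hsplit : finiteField β a i - ∫ y, W x y * (w y - w x) =
      ((∫ y, B y * (e y - e x)) + ∫ y, (B y - V y) * (w y - w x)) +
        ∫ y, (V y - W x y) * (w y - w x) := by
    have hI12 : Integrable fun y => B y * (e y - e x) + (B y - V y) * (w y - w x) := hI1.add hI2
    rw [hfield, ← integral_sub hI5 hI4, ← integral_add hI1 hI2, ← integral_add hI12 hI3]
    refine integral_congr_ae (ae_of_all _ fun y => ?_)
    simp only [he, ← hi]; ring
  have hb1 : |∫ y, B y * (e y - e x)| ≤ 2 * ‖f‖ + 2 * M * κ := by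
    have h10 : ∫ y, (|e y| + |e x|) = (∫ y, |e y|) + |e x| := by
      rw [integral_add heint.abs (integrable_const _)]; simp
    have h11 : |∫ y, B y * (e y - e x)| ≤ ∫ y, (|e y| + |e x|) := by
      have h12 : Integrable fun y => |e y| + |e x| := heint.abs.add (integrable_const _)
      rw [← Real.norm_eq_abs]
      refine norm_integral_le_of_norm_le h12 (ae_of_all _ fun y => ?_)
      rw [norm_mul]
      calc _ ≤ 1 * (|e y| + |e x|) := by
            gcongr
            · exact hBle y
            · exact abs_sub _ _
        _ = _ := one_mul _
    linarith
  have hb2 : |∫ y, (B y - V y) * (w y - w x)| ≤ (1 + M) * δ := by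
    have h10 : ∫ y, (B y - V y) * (w y - w x) =
        (1 / (n : ℝ) * ∑ j, (β i j - W (gridPoint n i) (gridPoint n j)) * discretize w n j) -
        (1 / (n : ℝ) * ∑ j, (β i j - W (gridPoint n i) (gridPoint n j))
          * discretize oneLInfty n j) * w x := by
      have h11 : ∫ y, (B y - V y) * w y =
          1 / (n : ℝ) * ∑ j, (β i j - W (gridPoint n i) (gridPoint n j)) * discretize w n j := by
        rw [Finset.mul_sum]
        refine (integral_cellIndex_mul
          (fun j => β i j - W (gridPoint n i) (gridPoint n j)) hwint).trans ?_
        refine Finset.sum_congr rfl fun j _ => ?_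
        rw [discretize]; field_simp
      have h12 : ∫ y, (B y - V y) = 1 / (n : ℝ) *
          ∑ j, (β i j - W (gridPoint n i) (gridPoint n j)) * discretize oneLInfty n j := by
        simp_rw [discretize_one, mul_one]
        exact integral_cellIndex (fun j => β i j - W (gridPoint n i) (gridPoint n j))
      rw [← h11, ← h12, ← integral_mul_const, ← integral_sub]
      · exact integral_congr_ae (ae_of_all _ fun y => by ring)
      · exact hwint.bdd_mul hBV.aestronglyMeasurable (ae_of_all _ hBVle)
      · exact (Integrable.of_bound hBV.aestronglyMeasurable 1 (ae_of_all _ hBVle)).mul_const _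
    rw [h10]
    refine (abs_sub _ _).trans ?_
    rw [abs_mul _ (w x)]
    have := mul_le_mul (h1 i) h7 (abs_nonneg _) hδ
    linarith [h2 i]
  have hb3 : |∫ y, (V y - W x y) * (w y - w x)| ≤ 2 * M * η := by
    have h11 : |∫ y, (V y - W x y) * (w y - w x)| ≤ ∫ y, 2 * M * |V y - W x y| := by
      rw [← Real.norm_eq_abs]
      refine norm_integral_le_of_norm_le
        ((Integrable.of_bound hVW.aestronglyMeasurable 1 (ae_of_all _ hVWle)).abs.const_mul _) ?_
      filter_upwards [hwM] with y hy
      rw [norm_mul, Real.norm_eq_abs, Real.norm_eq_abs, mul_comm]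
      gcongr
      linarith [abs_sub (w y) (w x)]
    rw [integral_const_mul] at h11
    refine h11.trans ?_
    gcongr
    exact hWE x h9
  rw [hsplit]
  refine (abs_add_le _ _).trans ?_
  have := abs_add_le (∫ y, B y * (e y - e x)) (∫ y, (B y - V y) * (w y - w x))
  linarith

lemma IsContinuumSolution.hasDerivAt {W : Graphon} {g : LInfty} {u : ℝ → LInfty}
    (hu : IsContinuumSolution W g u) {t : ℝ} (ht : 0 < t) : HasDerivAt u (deriv u t) t :=
  ((hu.contDiffOn.contDiffAt (Ici_mem_nhds ht)).differentiableAt one_ne_zero).hasDerivAt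

/-- The Grönwall estimate for the distance, in the supremum norm off an exceptional set, between
the solutions of the finite and of the continuum model. -/
lemma norm_restrict_solution_sub_le {W : Graphon} {g : LInfty} {u : ℝ → LInfty}
    (hu : IsContinuumSolution W g u) {n : ℕ} [NeZero n] {β : Fin n → Fin n → ℝ}
    (hβ : ∀ i j, β i j ∈ Set.Icc (0 : ℝ) 1) {v : ℝ → Fin n → ℝ}
    (hv : IsFiniteSolution β (discretize g n) v) {E : Set I} (hE : MeasurableSet E)
    {M κ δ η θ b : ℝ} (hη : 0 ≤ η) (hEκ : volume.real E ≤ κ)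
    (hgE : ∀ᵐ x ∂(volume.restrict Eᶜ), |stepFun (discretize g n) x - g x| ≤ θ) (hθ : 0 ≤ θ)
    (hWE : ∀ x ∉ E, ∫ y, |W (cellEnd n x) (cellEnd n y) - W x y| ≤ η)
    (hgM : ‖g‖ * Real.exp (2 * b) ≤ M) (huM : ∀ t ∈ Set.Icc 0 b, ‖u t‖ ≤ M)
    (h1 : ∀ i, |1 / (n : ℝ) * ∑ j, (β i j - W (gridPoint n i) (gridPoint n j))
      * discretize oneLInfty n j| ≤ δ)
    (h2 : ∀ t ∈ Set.Icc 0 b, ∀ i, |1 / (n : ℝ) * ∑ j,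
      (β i j - W (gridPoint n i) (gridPoint n j)) * discretize (u t) n j| ≤ δ)
    {t : ℝ} (ht : t ∈ Set.Icc 0 b) :
    ‖LpToLpRestrictCLM I ℝ ℝ volume ∞ Eᶜ (stepCLM n (v t) - u t)‖ ≤
      (θ + (2 * M * κ + (1 + M) * δ + 2 * M * η)) * Real.exp (2 * b) := by
  set R := LpToLpRestrictCLM I ℝ ℝ volume ∞ Eᶜ with hR
  have hM : 0 ≤ M := (by positivity : 0 ≤ ‖g‖ * Real.exp (2 * b)).trans hgM
  have hκ : 0 ≤ κ := measureReal_nonneg.trans hEκ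
  have hδ : 0 ≤ δ := (abs_nonneg _).trans (h1 0)
  have hg : ‖discretize g n‖ ≤ ‖g‖ :=
    (pi_norm_le_iff_of_nonneg (norm_nonneg _)).2 fun i => abs_discretize_le g i
  have hvM : ∀ s ∈ Set.Icc 0 b, ‖v s‖ ≤ M := fun s hs =>
    (hv.norm_le hβ hs).trans ((by gcongr : _ ≤ ‖g‖ * Real.exp (2 * b)).trans hgM)
  have h0 : ‖R (stepCLM n (v 0) - u 0)‖ ≤ θ := by
    rw [hv.init, hu.init]
    refine LInfty.norm_le _ hθ ?_
    filter_upwards [LpToLpRestrictCLM_coeFn ℝ Eᶜ (stepCLM n (discretize g n) - g),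
      ae_restrict_of_ae (Lp.coeFn_sub (stepCLM n (discretize g n)) g),
      ae_restrict_of_ae (stepCLM_coeFn (discretize g n)), hgE] with x h3 h4 h5 h6
    rw [h3, h4, Pi.sub_apply, h5]
    exact h6
  have h := norm_le_gronwallBound_of_hasDerivAt_Ioo (b := b)
    (f := fun s => R (stepCLM n (v s) - u s))
    (f' := fun s => R (stepCLM n (finiteField β (v s)) - deriv u s)) (K := 2)
    (ε := 2 * M * κ + (1 + M) * δ + 2 * M * η) two_ne_zero
    (R.continuous.comp_continuousOn
      (((stepCLM n).continuous.comp_continuousOn (hv.continuousOn.mono Set.Icc_subset_Ici_self)).sub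
        (hu.contDiffOn.continuousOn.mono Set.Icc_subset_Ici_self)))
    (fun s hs => R.hasFDerivAt.comp_hasDerivAt s
      (((stepCLM n).hasFDerivAt.comp_hasDerivAt s (hv.hasDerivAt hs.1)).sub (hu.hasDerivAt hs.1)))
    (fun s hs => norm_restrict_finiteField_sub_le hβ hE hη hEκ hWE (hvM s ⟨hs.1.le, hs.2.le⟩)
      (huM s ⟨hs.1.le, hs.2.le⟩) (hu.eqn s hs.1) h1 (h2 s ⟨hs.1.le, hs.2.le⟩)) ht
  refine h.trans ?_
  set C := 2 * M * κ + (1 + M) * δ + 2 * M * η with hC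
  have hC0 : 0 ≤ C := by positivity
  have hexp : Real.exp (2 * t) ≤ Real.exp (2 * b) := by gcongr; exact ht.2
  have hexp0 := Real.exp_pos (2 * b)
  rw [gronwallBound_of_K_ne_0 two_ne_zero, add_mul]
  have h3 : C / 2 * (Real.exp (2 * t) - 1) ≤ C * Real.exp (2 * b) := by
    have : C * (Real.exp (2 * b) - (Real.exp (2 * t) - 1) / 2) ≥ 0 :=
      mul_nonneg hC0 (by linarith)
    linarith
  have h4 := mul_le_mul h0 hexp (Real.exp_pos _).le hθ
  linarith

/-! ### Consensus of the finite model -/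

/-- The points outside `E` that lie in a cell, of some partition, which is almost contained
in `E`. -/
def negligibleCells (E : Set I) : Set I :=
  ⋃ (n : ℕ) (i : {i : Fin n // volume (cell n i \ E) = 0}), cell n i \ E

lemma measurableSet_negligibleCells {E : Set I} (hE : MeasurableSet E) :
    MeasurableSet (negligibleCells E) :=
  MeasurableSet.iUnion fun n => MeasurableSet.iUnion fun i => (measurableSet_cell n i).diff hE

lemma volume_negligibleCells (E : Set I) : volume (negligibleCells E) = 0 :=
  measure_iUnion_null fun _ => measure_iUnion_null fun i => i.2

lemma volume_cell_diff_ne_zero {E : Set I} {n : ℕ} [NeZero n] {x : I}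
    (hx : x ∉ E ∪ negligibleCells E) : volume (cell n (cellIndex n x) \ E) ≠ 0 := by
  intro h
  refine hx (Or.inr (Set.mem_iUnion.2 ⟨n, Set.mem_iUnion.2 ⟨⟨_, h⟩, ?_⟩⟩))
  exact ⟨mem_cell_cellIndex n x, fun hxE => hx (Or.inl hxE)⟩

/-- If a step function is close to `w` off `E`, and `w` is nearly constant, then so is the step
function, at every pair of points that lie in cells of which `E` does not cover almost everything:
the values on two such cells are compared at generic points of the cells. -/
lemma abs_stepFun_sub_le {n : ℕ} [NeZero n] {a : Fin n → ℝ} {w : LInfty} {E : Set I}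
    (hE : MeasurableSet E) {r s : ℝ}
    (ha : ‖LpToLpRestrictCLM I ℝ ℝ volume ∞ Eᶜ (stepCLM n a - w)‖ ≤ r)
    (hw : ∀ᵐ p : I × I, |w p.1 - w p.2| ≤ s) {x y : I}
    (hx : x ∉ E ∪ negligibleCells E) (hy : y ∉ E ∪ negligibleCells E) :
    |stepFun a x - stepFun a y| ≤ 2 * r + s := by
  have hae : ∀ᵐ z : I, z ∈ Eᶜ → |a (cellIndex n z) - w z| ≤ r := by
    rw [← ae_restrict_iff' hE.compl]
    filter_upwards [LInfty.ae_abs_le (LpToLpRestrictCLM I ℝ ℝ volume ∞ Eᶜ (stepCLM n a - w)),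
      LpToLpRestrictCLM_coeFn ℝ Eᶜ (stepCLM n a - w),
      ae_restrict_of_ae (Lp.coeFn_sub (stepCLM n a) w), ae_restrict_of_ae (stepCLM_coeFn a)]
      with z h3 h4 h5 h6
    rw [h4, h5, Pi.sub_apply, h6, stepFun_eq] at h3
    exact h3.trans ha
  have hpos : (volume : Measure (I × I))
      ((cell n (cellIndex n x) \ E) ×ˢ (cell n (cellIndex n y) \ E)) ≠ 0 := by
    rw [Measure.volume_eq_prod, Measure.prod_prod]
    exact mul_ne_zero (volume_cell_diff_ne_zero hx) (volume_cell_diff_ne_zero hy)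
  have h1 : ∀ᵐ p : I × I, p.1 ∈ Eᶜ → |a (cellIndex n p.1) - w p.1| ≤ r :=
    Measure.quasiMeasurePreserving_fst.ae hae
  have h2 : ∀ᵐ p : I × I, p.2 ∈ Eᶜ → |a (cellIndex n p.2) - w p.2| ≤ r :=
    Measure.quasiMeasurePreserving_snd.ae hae
  obtain ⟨p, ⟨hp1, hp2⟩, h3, h4, h5⟩ :=
    ((frequently_ae_mem_iff.2 hpos).and_eventually (h1.and (h2.and hw))).exists
  have h6 := h3 hp1.2
  have h7 := h4 hp2.2
  rw [(mem_cell_iff _ _).1 hp1.1] at h6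
  rw [(mem_cell_iff _ _).1 hp2.1] at h7
  rw [stepFun_eq, stepFun_eq]
  rw [abs_le] at *
  constructor <;> linarith [h5.1, h5.2, h6.1, h6.2, h7.1, h7.2]

lemma ReachesConsensus.exists_ae_abs_sub_le {u : ℝ → LInfty} (hu : ReachesConsensus u) {ε : ℝ}
    (hε : 0 < ε) :
    ∃ T : ℝ, 0 < T ∧ ∀ t, T ≤ t → ∀ᵐ p : I × I, |u t p.1 - u t p.2| ≤ ε := by
  obtain ⟨T, hT⟩ := eventually_atTop.1 (hu.eventually_lt_const (ENNReal.ofReal_pos.2 hε))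
  refine ⟨max T 1, by positivity, fun t ht => ?_⟩
  filter_upwards [ae_lt_of_essSup_lt (hT t ((le_max_left _ _).trans ht))] with p hp
  rw [← Real.norm_eq_abs, ← toReal_enorm]
  exact ENNReal.toReal_le_of_le_ofReal hε.le hp.le

/-- Everything that, for large `n`, holds off events whose probability tends to `0` holds
asymptotically almost surely. No measurability is needed. -/
lemma asymptoticallyAlmostSurely_of_compl_subset {Ω : ℕ → Type*} [∀ n, MeasurableSpace (Ω n)]
    {P : ∀ n, Measure (Ω n)} [∀ n, IsProbabilityMeasure (P n)] {A B : ∀ n, Set (Ω n)}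
    (hB : Tendsto (fun n => P n (B n)) atTop (𝓝 0)) (hAB : ∀ᶠ n in atTop, (B n)ᶜ ⊆ A n) :
    AsymptoticallyAlmostSurely P A := by
  have h1 : Tendsto (fun n => 1 - P n (B n)) atTop (𝓝 1) := by
    simpa using ENNReal.Tendsto.sub (tendsto_const_nhds (x := (1 : ℝ≥0∞))) hB
      (Or.inl ENNReal.one_ne_top)
  refine tendsto_of_tendsto_of_tendsto_of_le_of_le' h1 tendsto_const_nhds ?_
    (Eventually.of_forall fun n => prob_le_one)
  filter_upwards [hAB] with n hn
  rw [tsub_le_iff_left]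
  calc (1 : ℝ≥0∞) = P n (B n ∪ (B n)ᶜ) := by rw [Set.union_compl_self, measure_univ]
    _ ≤ P n (B n) + P n (B n)ᶜ := measure_union_le _ _
    _ ≤ P n (B n) + P n (A n) := by gcongr

theorem mainTheorem7 (W : Graphon) (hW : W.AEContinuous) (g : LInfty) (u : ℝ → LInfty)
    (hu : IsContinuumSolution W g u) (hpos : PositivityCondition W u)
    {Ω : ℕ → Type*} [∀ n, MeasurableSpace (Ω n)] (P : ∀ n, Measure (Ω n))
    [∀ n, IsProbabilityMeasure (P n)]
    (G : ∀ n, Ω n → SimpleGraph (Fin n)) (hG : ∀ n, IsWRandomGraph (P n) W n (G n))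
    (v : ∀ n, Ω n → ℝ → Fin n → ℝ)
    (hv : ∀ n ω, IsFiniteSolution (edgeWeight (G n ω)) (discretize g n) (v n ω))
    (hcons : ReachesConsensus u) :
    ∀ ε : ℝ, 0 < ε → ∃ T : ℝ, 0 < T ∧ ∀ D : ℝ, 0 < D → ∀ c : ℝ, 0 < c →
      ∃ S : ℝ → Set (I × I),
        (∀ t, MeasurableSet (S t) ∧ volume (S t) < ENNReal.ofReal (c ^ 2)) ∧
        AsymptoticallyAlmostSurely P (fun n => {ω | ∀ t ∈ Set.Icc T (T + D),
          ∀ x y : I, (x, y) ∉ S t →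
            |stepFun (v n ω t) x - stepFun (v n ω t) y| ≤ ε}) := by
  intro ε hε
  obtain ⟨T, hT, hcT⟩ := hcons.exists_ae_abs_sub_le (half_pos hε)
  refine ⟨T, hT, fun D hD c hc => ?_⟩
  set b := T + D with hb
  have hucont : ContinuousOn u (Set.Icc 0 b) :=
    hu.contDiffOn.continuousOn.mono Set.Icc_subset_Ici_self
  obtain ⟨M₀, hM₀⟩ := isCompact_Icc.exists_bound_of_continuousOn hucont
  set M := max M₀ (‖g‖ * Real.exp (2 * b)) with hM
  have hMpos : 0 ≤ M := (by positivity : 0 ≤ ‖g‖ * Real.exp (2 * b)).trans (le_max_right _ _)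
  have hL := Real.exp_pos (2 * b)
  -- with all the error terms equal to `τ`, the Grönwall estimate gives exactly `ε / 4`
  set τ := ε / (4 * Real.exp (2 * b) * (2 + 5 * M)) with hτ
  have hτpos : 0 < τ := by positivity
  have hκpos : 0 < min τ (c ^ 2 / 3) := by positivity
  obtain ⟨E, hE, hEκ, hEη⟩ := exists_uniform_approximation hW g hκpos
  have hEτ : volume.real E ≤ τ :=
    (ENNReal.toReal_le_of_le_ofReal hκpos.le hEκ).trans (min_le_left _ _)
  obtain ⟨B, hB, hBK⟩ := tendsto_measure_forall_row_sum_le hG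
    ((isCompact_Icc.image_of_continuousOn hucont).union (isCompact_singleton (x := oneLInfty))) hτpos
  set E' := E ∪ negligibleCells E with hE'
  have hE'm : MeasurableSet E' := hE.union (measurableSet_negligibleCells hE)
  have hE'v : volume E' ≤ ENNReal.ofReal (c ^ 2 / 3) := by
    refine (measure_union_le _ _).trans ?_
    rw [volume_negligibleCells, add_zero]
    exact hEκ.trans (ENNReal.ofReal_le_ofReal (min_le_right _ _))
  refine ⟨fun _ => E' ×ˢ Set.univ ∪ Set.univ ×ˢ E', fun _ => ⟨?_, ?_⟩, ?_⟩
  · exact (hE'm.prod MeasurableSet.univ).union (MeasurableSet.univ.prod hE'm)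
  · refine (measure_union_le _ _).trans_lt ?_
    rw [Measure.volume_eq_prod, Measure.prod_prod, Measure.prod_prod, measure_univ, mul_one,
      one_mul]
    refine (add_le_add hE'v hE'v).trans_lt ?_
    rw [← ENNReal.ofReal_add (by positivity) (by positivity),
      ENNReal.ofReal_lt_ofReal_iff (by positivity)]
    have : 0 < c ^ 2 := by positivity
    linarith
  · refine asymptoticallyAlmostSurely_of_compl_subset hB ?_
    filter_upwards [hEη τ hτpos, eventually_ne_atTop 0] with n hn hn0 ω hω t ht x y hxy
    have : NeZero n := ⟨hn0⟩
    have hx : x ∉ E' := fun h => hxy (Or.inl ⟨h, trivial⟩)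
    have hy : y ∉ E' := fun h => hxy (Or.inr ⟨trivial, h⟩)
    have hdist := norm_restrict_solution_sub_le hu (b := b)
      (fun i j => edgeWeight_mem_Icc (G n ω) i j) (hv n ω) hE hτpos.le hEτ hn.1 hτpos.le hn.2
      (le_max_right _ _) (fun s hs => (hM₀ s hs).trans (le_max_left _ _))
      (hBK n hn0 ω hω _ (Or.inr rfl))
      (fun s hs => hBK n hn0 ω hω _ (Or.inl (Set.mem_image_of_mem u hs)))
      ⟨hT.le.trans ht.1, ht.2⟩
    have hτε : (τ + (2 * M * τ + (1 + M) * τ + 2 * M * τ)) * Real.exp (2 * b) = ε / 4 := by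
      rw [hτ]; field_simp; ring
    rw [hτε] at hdist
    exact (abs_stepFun_sub_le hE hdist (hcT t ht.1) hx hy).trans (by linarith)
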